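/- \textbf{Proposition (Existence and uniqueness for a variational inequality).} Let $K\subset\mathbb{R}^m$ be nonempty, closed and convex. For $G:K\to\mathbb{R}^m$, a solution of $\operatorname{VI}(G,K)$ is a point $y\in K$ such that $(v-y)^T G(y)\ge 0$ for all $v\in K$. Call $G$ \emph{strictly monotone} on $K$ if $(u-v)^T(G(u)-G(v))>0$ for all $u,v\in K$ with $u\ne v$, and \emph{strongly monotone} on $K$ if there is a constant $c>0$ such that $(u-v)^T(G(u)-G(v))\ge c\|u-v\|^2$ for all $u,v\in K$, where $\|\cdot\|$ is the Euclidean norm. (1) If $K$ is compact and $G:K\to\mathbb{R}^m$ is continuous, then $\operatorname{VI}(G,K)$ has a solution. (2) If $K$ is compact and $G:K\to\mathbb{R}^m$ is continuous and strictly monotone on $K$, then $\operatorname{VI}(G,K)$ has exactly one solution. (3) If $G:K\to\mathbb{R}^m$ is continuous and strongly monotone on $K$ (where $K$ may be unbounded), then $\operatorname{VI}(G,K)$ has exactly one solution. (4) If $K$ is unbounded, then continuity of $G$ alone does not suffice for existence: there is a continuous $G:K\to\mathbb{R}^m$ such that $\operatorname{VI}(G,K)$ has no solution. -/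

import Mathlib

namespace VI

/-- The solution set of the variational inequality `VI(G, K)` in `ℝᵐ`: the points `y ∈ K` such that
`(v - y)ᵀ G(y) ≥ 0` for all `v ∈ K`. Only the values of `G` on `K` matter. -/
def solutionSet {m : ℕ} (G : EuclideanSpace ℝ (Fin m) → EuclideanSpace ℝ (Fin m))
    (K : Set (EuclideanSpace ℝ (Fin m))) : Set (EuclideanSpace ℝ (Fin m)) :=
  {y | y ∈ K ∧ ∀ v ∈ K, 0 ≤ inner ℝ (v - y) (G y)}

/-- `G` is strictly monotone on `K`: `(u - v)ᵀ (G(u) - G(v)) > 0` for all `u ≠ v` in `K`. -/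
def StrictlyMonotoneOn {m : ℕ} (G : EuclideanSpace ℝ (Fin m) → EuclideanSpace ℝ (Fin m))
    (K : Set (EuclideanSpace ℝ (Fin m))) : Prop :=
  ∀ u ∈ K, ∀ v ∈ K, u ≠ v → 0 < inner ℝ (u - v) (G u - G v)

/-- `G` is strongly monotone on `K`: for some `c > 0`,
`(u - v)ᵀ (G(u) - G(v)) ≥ c ‖u - v‖²` for all `u, v ∈ K`. -/
def StronglyMonotoneOn {m : ℕ} (G : EuclideanSpace ℝ (Fin m) → EuclideanSpace ℝ (Fin m))
    (K : Set (EuclideanSpace ℝ (Fin m))) : Prop :=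
  ∃ c : ℝ, 0 < c ∧ ∀ u ∈ K, ∀ v ∈ K, c * ‖u - v‖ ^ 2 ≤ inner ℝ (u - v) (G u - G v)

end VI

/-!
A fixed point of `y ↦ P (y - G y)`, where `P` is the metric projection onto `K`, solves `VI(G, K)`,
so existence on compact sets is Brouwer's theorem. If Brouwer's theorem failed, there would be a
Lipschitz retraction `r` of a ball onto its sphere that is differentiable inside; its Jacobian
vanishes there, because `r` has constant norm. But the Jacobian of `x + t (r x - x)` integrates to
the volume of the ball for small `t`, by the change of variables formula, and is polynomial in `t`,
so it still does for `t = 1`.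

For strongly monotone `G` a solution on a truncated set lies within a distance of the centre that
does not depend on the truncation, and being a solution is a local property on convex sets.
If every constant `G` admitted a solution, every linear functional would be bounded below on `K`,
and `K` would be bounded by the uniform boundedness principle.
-/

open MeasureTheory Metric Set Topology
open scoped Manifold NNReal

section MonotoneMaps

variable {E : Type*} [NormedAddCommGroup E] [InnerProductSpace ℝ E]

/-- The solution set of `VI(G, K)` in a real inner product space. For `E = EuclideanSpace ℝ (Fin m)`
it is `VI.solutionSet G K` by definition, and likewise for the two notions of monotonicity below. -/
def viSolutionSet (G : E → E) (K : Set E) : Set E :=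
  {y | y ∈ K ∧ ∀ v ∈ K, 0 ≤ inner ℝ (v - y) (G y)}

/-- Strict monotonicity on `K` of a map from a real inner product space to itself. -/
def IsStrictlyMonotoneOn (G : E → E) (K : Set E) : Prop :=
  ∀ u ∈ K, ∀ v ∈ K, u ≠ v → 0 < inner ℝ (u - v) (G u - G v)

/-- Strong monotonicity on `K`, with constant `c`, of a map from a real inner product space to
itself. The positivity of `c` is not part of the definition. -/
def IsStronglyMonotoneOn (c : ℝ) (G : E → E) (K : Set E) : Prop :=
  ∀ u ∈ K, ∀ v ∈ K, c * ‖u - v‖ ^ 2 ≤ inner ℝ (u - v) (G u - G v)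

variable {G H : E → E} {K s : Set E} {c : ℝ} {x y z : E}

theorem IsStronglyMonotoneOn.mono (hG : IsStronglyMonotoneOn c G K) (hs : s ⊆ K) :
    IsStronglyMonotoneOn c G s :=
  fun u hu v hv => hG u (hs hu) v (hs hv)

theorem isStronglyMonotoneOn_sub_const (x : E) (K : Set E) :
    IsStronglyMonotoneOn 1 (fun p => p - x) K := fun u _ v _ => by
  rw [sub_sub_sub_cancel_right, real_inner_self_eq_norm_sq, one_mul]

theorem IsStronglyMonotoneOn.isStrictlyMonotoneOn (hc : 0 < c) (hG : IsStronglyMonotoneOn c G K) :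
    IsStrictlyMonotoneOn G K := fun u hu v hv huv =>
  have : 0 < ‖u - v‖ := norm_sub_pos_iff.2 huv
  (by positivity : 0 < c * ‖u - v‖ ^ 2).trans_le (hG u hu v hv)

theorem inner_sub_sub_nonpos_of_mem_viSolutionSet (hy : y ∈ viSolutionSet G K)
    (hz : z ∈ viSolutionSet H K) : inner ℝ (y - z) (G y - H z) ≤ 0 := by
  have hyz := hy.2 z hz.1
  have hzy := hz.2 y hy.1
  rw [← neg_sub, inner_neg_left] at hyz
  rw [inner_sub_right]
  linarith

theorem IsStrictlyMonotoneOn.subsingleton_viSolutionSet (hG : IsStrictlyMonotoneOn G K) :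
    (viSolutionSet G K).Subsingleton := fun y hy z hz => by
  by_contra hyz
  exact (hG y hy.1 z hz.1 hyz).not_ge (inner_sub_sub_nonpos_of_mem_viSolutionSet hy hz)

theorem IsStronglyMonotoneOn.mul_norm_sub_le (hG : IsStronglyMonotoneOn c G K)
    (hy : y ∈ viSolutionSet G K) (hz : z ∈ viSolutionSet H K) :
    c * ‖y - z‖ ≤ ‖H z - G z‖ := by
  rcases (norm_nonneg (y - z)).eq_or_lt with h0 | hpos
  · rw [← h0, mul_zero]
    exact norm_nonneg _
  refine le_of_mul_le_mul_right ?_ hpos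
  calc c * ‖y - z‖ * ‖y - z‖ = c * ‖y - z‖ ^ 2 := by ring
    _ ≤ inner ℝ (y - z) (G y - G z) := hG y hy.1 z hz.1
    _ = inner ℝ (y - z) (G y - H z) + inner ℝ (y - z) (H z - G z) := by
      rw [← inner_add_right, sub_add_sub_cancel]
    _ ≤ inner ℝ (y - z) (H z - G z) :=
      add_le_of_nonpos_left (inner_sub_sub_nonpos_of_mem_viSolutionSet hy hz)
    _ ≤ ‖y - z‖ * ‖H z - G z‖ := real_inner_le_norm _ _
    _ = ‖H z - G z‖ * ‖y - z‖ := mul_comm _ _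

theorem mem_viSolutionSet_of_eq_zero (hy : y ∈ K) (hGy : G y = 0) : y ∈ viSolutionSet G K :=
  ⟨hy, fun v _ => by rw [hGy, inner_zero_right]⟩

theorem mem_viSolutionSet_of_inter_nhds (hK : Convex ℝ K) (hs : s ∈ 𝓝 y)
    (hy : y ∈ viSolutionSet G (K ∩ s)) : y ∈ viSolutionSet G K := by
  have hlocal : IsLocalMinOn (innerSL ℝ (G y)) K y := by
    filter_upwards [inter_mem_nhdsWithin K hs] with v hv
    have := hy.2 v hv
    rwa [real_inner_comm, inner_sub_right, sub_nonneg] at this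
  have hmin := IsMinOn.of_isLocalMinOn_of_convexOn hy.1.1 hlocal
    ((innerSL ℝ (G y)).toLinearMap.convexOn hK)
  refine ⟨hy.1.1, fun v hv => ?_⟩
  rw [real_inner_comm, inner_sub_right, sub_nonneg]
  exact hmin hv

theorem eq_zero_of_mem_viSolutionSet_of_mem_interior (hy : y ∈ viSolutionSet G K)
    (hint : y ∈ interior K) : G y = 0 := by
  have huniv : y ∈ viSolutionSet G univ := mem_viSolutionSet_of_inter_nhds convex_univ
    (mem_interior_iff_mem_nhds.1 hint) (by rwa [univ_inter])
  have h := huniv.2 (y - G y) (mem_univ _)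
  rw [sub_sub_cancel_left, inner_neg_left, neg_nonneg] at h
  exact real_inner_self_nonpos.1 h

theorem exists_viSolutionSet_const_eq_empty [CompleteSpace E] (hK : ¬ Bornology.IsBounded K) :
    ∃ w : E, viSolutionSet (fun _ => w) K = ∅ := by
  by_contra! hsol
  have hbelow (w : E) : ∃ C, ∀ v ∈ K, -C ≤ inner ℝ v w := by
    obtain ⟨y, -, hy⟩ := hsol w
    refine ⟨-inner ℝ y w, fun v hv => ?_⟩
    rw [neg_neg, ← sub_nonneg, ← inner_sub_left]
    exact hy v hv
  have hweak (w : E) : ∃ C, ∀ v : K, ‖innerSL ℝ (v : E) w‖ ≤ C := by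
    obtain ⟨C, hC⟩ := hbelow w
    obtain ⟨D, hD⟩ := hbelow (-w)
    refine ⟨max C D, fun v => abs_le'.2 ⟨?_, ?_⟩⟩
    · have := hD v v.2
      rw [inner_neg_right, neg_le_neg_iff] at this
      exact this.trans (le_max_right _ _)
    · exact (neg_le.1 (hC v v.2)).trans (le_max_left _ _)
  obtain ⟨C, hC⟩ := banach_steinhaus hweak
  exact hK (isBounded_iff_forall_norm_le.2
    ⟨C, fun v hv => (innerSL_apply_norm ℝ v).symm.trans_le (hC ⟨v, hv⟩)⟩)

end MonotoneMaps

section MetricProjection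

variable {E : Type*} [NormedAddCommGroup E] [InnerProductSpace ℝ E] {K : Set E} {P : E → E} {x : E}

/-- `P` is the metric projection onto `K`. It is encoded by the obtuse-angle characterization of the
nearest point, which says that `P x` solves `VI(p ↦ p - x, K)`. -/
def IsMetricProjection (K : Set E) (P : E → E) : Prop :=
  ∀ x, P x ∈ viSolutionSet (fun p => p - x) K

theorem exists_isMetricProjection (hne : K.Nonempty) (hK : IsComplete K) (hconv : Convex ℝ K) :
    ∃ P, IsMetricProjection K P := by
  choose P hPK hP using exists_norm_eq_iInf_of_complete_convex hne hK hconv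
  refine ⟨P, fun x => ⟨hPK x, fun v hv => ?_⟩⟩
  have hangle := (norm_eq_iInf_iff_real_inner_le_zero hconv (hPK x)).1 (hP x) v hv
  change 0 ≤ inner ℝ (v - P x) (P x - x)
  rwa [← neg_sub x, inner_neg_right, neg_nonneg, real_inner_comm]

namespace IsMetricProjection

theorem apply_mem (hP : IsMetricProjection K P) (x : E) : P x ∈ K := (hP x).1

theorem lipschitzWith (hP : IsMetricProjection K P) : LipschitzWith 1 P :=
  LipschitzWith.of_dist_le_mul fun x y => by
    have h := (isStronglyMonotoneOn_sub_const x K).mul_norm_sub_le (hP x) (hP y)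
    rwa [one_mul, sub_sub_sub_cancel_left, ← dist_eq_norm, ← dist_eq_norm,
      ← one_mul (dist x y)] at h

theorem apply_eq_self (hP : IsMetricProjection K P) (hx : x ∈ K) : P x = x :=
  ((isStronglyMonotoneOn_sub_const x K).isStrictlyMonotoneOn one_pos).subsingleton_viSolutionSet
    (hP x) (mem_viSolutionSet_of_eq_zero hx (sub_self x))

theorem apply_mem_frontier (hP : IsMetricProjection K P) (hx : x ∉ interior K) :
    P x ∈ frontier K := by
  refine ⟨subset_closure (hP.apply_mem x), fun hint => hx ?_⟩
  have hfix := eq_zero_of_mem_viSolutionSet_of_mem_interior (hP x) hint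
  rw [sub_eq_zero] at hfix
  rwa [hfix] at hint

end IsMetricProjection

end MetricProjection

section Determinant

open Module Polynomial

variable {k V : Type*} [Field k] [AddCommGroup V] [Module k V] [FiniteDimensional k V]

theorem exists_polynomial_eval_eq_det_one_add_smul (A : End k V) :
    ∃ p : k[X], p.natDegree ≤ finrank k V ∧ ∀ t, p.eval t = LinearMap.det (1 + t • A) := by
  let M := LinearMap.toMatrix (finBasis k V) (finBasis k V) A
  refine ⟨((X : k[X]) • M.map C + (1 : Matrix _ _ k).map C).det, ?_, fun t => ?_⟩
  · simpa only [Fintype.card_fin] using natDegree_det_X_add_C_le M 1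
  · have hA : LinearMap.toMatrix (finBasis k V) (finBasis k V) (1 + t • A) = t • M + 1 := by
      rw [map_add, map_smul, LinearMap.toMatrix_one, add_comm]
    rw [← LinearMap.det_toMatrix (finBasis k V), hA, ← coe_evalRingHom, RingHom.map_det]
    congr 1
    ext i j
    by_cases hij : i = j <;> simp [hij, mul_comm t]

theorem exists_det_one_add_eq_sum_det_one_add_smul {s : Finset k} (hs : finrank k V < s.card) :
    ∃ w : k → k, ∑ t ∈ s, w t = 1 ∧
      ∀ A : End k V, LinearMap.det (1 + A) = ∑ t ∈ s, w t * LinearMap.det (1 + t • A) := by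
  classical
  have hinj : InjOn id (s : Set k) := injOn_id _
  let w (t : k) : k := (Lagrange.basis s id t).eval 1
  have hw (A : End k V) :
      LinearMap.det (1 + A) = ∑ t ∈ s, w t * LinearMap.det (1 + t • A) := by
    obtain ⟨p, hdeg, hp⟩ := exists_polynomial_eval_eq_det_one_add_smul A
    have hlt : p.degree < s.card :=
      degree_le_natDegree.trans_lt (by exact_mod_cast hdeg.trans_lt hs)
    have h := congrArg (eval 1) (Lagrange.eq_interpolate hinj hlt)
    rw [hp, one_smul, Lagrange.interpolate_apply, eval_finsetSum] at h
    rw [h]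
    exact Finset.sum_congr rfl fun t _ => by rw [eval_mul, eval_C, id, hp, mul_comm]
  refine ⟨w, ?_, hw⟩
  simpa using (hw 0).symm

theorem det_one_add_pos_of_norm_lt_one {E : Type*} [NormedAddCommGroup E] [NormedSpace ℝ E]
    [FiniteDimensional ℝ E] {A : E →L[ℝ] E} (hA : ‖A‖ < 1) : 0 < (1 + A).det := by
  have : CompleteSpace E := FiniteDimensional.complete ℝ E
  have hcont : Continuous fun B : E →L[ℝ] E => (1 + B).det :=
    ContinuousLinearMap.continuous_det.comp (continuous_const.add continuous_id)
  have hne : ∀ B ∈ ball (0 : E →L[ℝ] E) 1, (1 + B).det ≠ 0 := fun B hB => by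
    have hunit : IsUnit (1 + B) := by
      rw [← sub_neg_eq_add]
      exact isUnit_one_sub_of_norm_lt_one (by rwa [norm_neg, ← mem_ball_zero_iff])
    exact (LinearMap.isUnit_det _ (hunit.map ContinuousLinearMap.toLinearMapRingHom)).ne_zero
  by_contra! hle
  obtain ⟨B, hB, hdet⟩ := (convex_ball (0 : E →L[ℝ] E) 1).isPreconnected.intermediate_value
    (mem_ball_zero_iff.2 hA) (mem_ball_self one_pos) hcont.continuousOn
    (show (0 : ℝ) ∈ Icc ((1 + A).det) ((1 + (0 : E →L[ℝ] E)).det) from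
      ⟨hle, by simp [ContinuousLinearMap.det]⟩)
  exact hne B hB hdet

end Determinant

section JacobianIntegral

variable {E : Type*} [NormedAddCommGroup E] {h : E → E} {U : Set E} {L : ℝ≥0}

theorem bijective_id_add_of_lipschitzWith [CompleteSpace E] (hL : LipschitzWith L h)
    (hL1 : L < 1) : Function.Bijective fun x => x + h x := by
  have hcontr (y : E) : ContractingWith L fun x => y - h x :=
    ⟨hL1, LipschitzWith.of_dist_le_mul fun a b => by
      rw [dist_sub_left]
      exact hL.dist_le_mul a b⟩
  have hfix {x y : E} : x + h x = y ↔ Function.IsFixedPt (fun x => y - h x) x := by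
    rw [Function.IsFixedPt, sub_eq_iff_eq_add, eq_comm]
  exact ⟨fun x x' hx => (hcontr (x' + h x')).fixedPoint_unique' (hfix.1 hx) (hfix.1 rfl),
    fun y => ⟨_, hfix.2 (hcontr y).fixedPoint_isFixedPt⟩⟩

theorem bijOn_id_add_of_bijective (hbij : Function.Bijective fun x => x + h x)
    (h0 : ∀ x ∉ U, h x = 0) : BijOn (fun x => x + h x) U U := by
  refine ⟨fun x hx => ?_, hbij.injective.injOn, fun y hy => ?_⟩
  · by_contra hmem
    have hfix : x + h x = x := hbij.injective (by simp only [h0 _ hmem, add_zero])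
    exact hmem (by simpa only [hfix] using hx)
  · obtain ⟨x, rfl⟩ := hbij.surjective y
    refine ⟨x, ?_, rfl⟩
    by_contra hmem
    simp only [h0 x hmem, add_zero] at hy
    exact hmem hy

variable [NormedSpace ℝ E] [FiniteDimensional ℝ E] [MeasurableSpace E] [BorelSpace E]
  (μ : Measure E) [μ.IsAddHaarMeasure] {h' : E → E →L[ℝ] E}

theorem integrableOn_and_setIntegral_det_one_add_of_contraction (hU : MeasurableSet U)
    (hμ : μ U ≠ ⊤) (hL : LipschitzWith L h) (hL1 : L < 1) (h0 : ∀ x ∉ U, h x = 0)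
    (hh' : ∀ x ∈ U, HasFDerivAt h (h' x) x) :
    IntegrableOn (fun x => (1 + h' x).det) U μ ∧ ∫ x in U, (1 + h' x).det ∂μ = μ.real U := by
  have : CompleteSpace E := FiniteDimensional.complete ℝ E
  have hbij := bijOn_id_add_of_bijective (bijective_id_add_of_lipschitzWith hL hL1) h0
  have hderiv : ∀ x ∈ U, HasFDerivWithinAt (fun x => x + h x) (1 + h' x) U x := fun x hx =>
    ((hasFDerivAt_id x).add (hh' x hx)).hasFDerivWithinAt
  have hjac : ∀ x ∈ U, |(1 + h' x).det| • (1 : ℝ) = (1 + h' x).det := fun x hx => by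
    have hnorm : ‖h' x‖ < 1 := ((hh' x hx).le_of_lipschitz hL).trans_lt (by exact_mod_cast hL1)
    rw [abs_of_pos (det_one_add_pos_of_norm_lt_one hnorm), smul_eq_mul, mul_one]
  constructor
  · rw [← integrableOn_congr_fun hjac hU,
      ← integrableOn_image_iff_integrableOn_abs_det_fderiv_smul μ hU hderiv hbij.injOn fun _ => 1,
      hbij.image_eq]
    exact integrableOn_const hμ
  · rw [← setIntegral_congr_fun hU hjac,
      ← integral_image_eq_integral_abs_det_fderiv_smul μ hU hderiv hbij.injOn fun _ => 1,
      hbij.image_eq, setIntegral_const, smul_eq_mul, mul_one]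

theorem setIntegral_det_one_add_of_lipschitzWith (hU : MeasurableSet U) (hμ : μ U ≠ ⊤)
    (hL : LipschitzWith L h) (h0 : ∀ x ∉ U, h x = 0) (hh' : ∀ x ∈ U, HasFDerivAt h (h' x) x) :
    ∫ x in U, (1 + h' x).det ∂μ = μ.real U := by
  obtain ⟨s, hs, hcard⟩ := (Ioo_infinite (a := 0) (b := ((L : ℝ) + 1)⁻¹)
    (by positivity)).exists_subset_card_eq (Module.finrank ℝ E + 1)
  have hsmall : ∀ t ∈ s, IntegrableOn (fun x => (1 + t • h' x).det) U μ ∧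
      ∫ x in U, (1 + t • h' x).det ∂μ = μ.real U := fun t ht => by
    have hlt : ‖t‖₊ * L < 1 := by
      rw [← NNReal.coe_lt_coe, NNReal.coe_mul, coe_nnnorm, Real.norm_of_nonneg (hs ht).1.le]
      calc t * L ≤ ((L : ℝ) + 1)⁻¹ * L := by gcongr; exact (hs ht).2.le
        _ < 1 := by rw [inv_mul_lt_one₀ (by positivity)]; exact lt_add_one _
    exact integrableOn_and_setIntegral_det_one_add_of_contraction μ hU hμ
      ((lipschitzWith_smul t).comp hL) hlt
      (fun x hx => by rw [Function.comp_apply, h0 x hx, smul_zero])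
      (fun x hx => (hh' x hx).const_smul t)
  obtain ⟨w, hw, hdet⟩ := exists_det_one_add_eq_sum_det_one_add_smul (V := E)
    (s := s) (hcard ▸ Nat.lt_succ_self _)
  calc ∫ x in U, (1 + h' x).det ∂μ
      = ∫ x in U, ∑ t ∈ s, w t * (1 + t • h' x).det ∂μ := by
        congr 1; ext x; exact hdet _
    _ = ∑ t ∈ s, w t * ∫ x in U, (1 + t • h' x).det ∂μ := by
        rw [integral_finsetSum _ fun t ht => (hsmall t ht).1.const_mul _]
        simp only [integral_const_mul]
    _ = ∑ t ∈ s, w t * μ.real U := Finset.sum_congr rfl fun t ht => by rw [(hsmall t ht).2]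
    _ = μ.real U := by rw [← Finset.sum_mul, hw, one_mul]

end JacobianIntegral

section Brouwer

variable {E : Type*} [NormedAddCommGroup E] [InnerProductSpace ℝ E] [FiniteDimensional ℝ E]
  {K : Set E} {R : ℝ} {f G r : E → E}

theorem det_eq_zero_of_eventually_norm_eq {r' : E →L[ℝ] E} {x : E} (hR : R ≠ 0)
    (hr : HasFDerivAt r r' x) (hn : ∀ᶠ y in 𝓝 x, ‖r y‖ = R) : r'.det = 0 := by
  by_contra hdet
  obtain ⟨v, hv⟩ := (LinearMap.equivOfDetNeZero (r' : E →ₗ[ℝ] E) hdet).surjective (r x)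
  replace hv : r' v = r x := hv
  have hconst : HasFDerivAt (fun y => ‖r y‖ ^ 2) (0 : E →L[ℝ] ℝ) x :=
    (hasFDerivAt_const (R ^ 2) x).congr_of_eventuallyEq (hn.mono fun y hy => by simp only [hy])
  have horth := congrArg (fun T : E →L[ℝ] ℝ => T v) (hr.norm_sq.unique hconst)
  have hrx : r x = 0 := by simpa [hv] using horth
  exact hR (by rw [← hn.self_of_nhds, hrx, norm_zero])

theorem exists_mem_sphere_ne_of_mapsTo_sphere (hR : 0 < R) {L : ℝ≥0}
    (hL : LipschitzOnWith L r (closedBall 0 R)) (hd : DifferentiableOn ℝ r (ball 0 R))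
    (hr : MapsTo r (closedBall 0 R) (sphere 0 R)) : ∃ x ∈ sphere (0 : E) R, r x ≠ x := by
  by_contra! hid
  borelize E
  obtain ⟨P, hP⟩ := exists_isMetricProjection (nonempty_closedBall.2 hR.le)
    (isClosed_closedBall (x := (0 : E)) (ε := R)).isComplete (convex_closedBall 0 R)
  have hlip : LipschitzWith (L * 1 + 1) fun x => r (P x) - P x :=
    (lipschitzOnWith_univ.1 (hL.comp hP.lipschitzWith.lipschitzOnWith
      fun x _ => hP.apply_mem x)).sub hP.lipschitzWith
  have hsupp : ∀ x ∉ ball (0 : E) R, r (P x) - P x = 0 := fun x hx => by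
    rw [← interior_closedBall _ hR.ne'] at hx
    have hPx := hP.apply_mem_frontier hx
    rw [frontier_closedBall _ hR.ne'] at hPx
    exact sub_eq_zero.2 (hid _ hPx)
  have hnhds : ∀ x ∈ ball (0 : E) R, closedBall 0 R ∈ 𝓝 x := fun x hx =>
    Filter.mem_of_superset (isOpen_ball.mem_nhds hx) ball_subset_closedBall
  have hderiv : ∀ x ∈ ball (0 : E) R, HasFDerivAt r (fderiv ℝ r x) x := fun x hx =>
    (hd.differentiableAt (isOpen_ball.mem_nhds hx)).hasFDerivAt
  have hderivP : ∀ x ∈ ball (0 : E) R,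
      HasFDerivAt (fun x => r (P x) - P x) (fderiv ℝ r x - 1) x := fun x hx =>
    ((hderiv x hx).sub (hasFDerivAt_id x)).congr_of_eventuallyEq <| by
      filter_upwards [hnhds x hx] with y hy
      rw [hP.apply_eq_self hy, Pi.sub_apply, id]
  have hdet : ∀ x ∈ ball (0 : E) R, (1 + (fderiv ℝ r x - 1)).det = 0 := fun x hx => by
    rw [add_sub_cancel]
    refine det_eq_zero_of_eventually_norm_eq hR.ne' (hderiv x hx) ?_
    filter_upwards [hnhds x hx] with y hy
    exact mem_sphere_zero_iff_norm.1 (hr hy)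
  have hvol := setIntegral_det_one_add_of_lipschitzWith Measure.addHaar measurableSet_ball
    measure_ball_lt_top.ne hlip hsupp hderivP
  rw [setIntegral_congr_fun measurableSet_ball hdet, integral_zero] at hvol
  exact (ENNReal.toReal_pos (measure_ball_pos _ _ hR).ne' measure_ball_lt_top.ne).ne hvol

theorem exists_mem_closedBall_eq_zero_of_contDiff (hR : 0 < R) (hG : ContDiff ℝ 1 G)
    (hid : ∀ x ∈ sphere (0 : E) R, G x = x) : ∃ x ∈ closedBall (0 : E) R, G x = 0 := by
  by_contra! hne
  have hsmooth : ContDiffOn ℝ 1 (fun x => (R / ‖G x‖) • G x) (closedBall 0 R) :=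
    (contDiffOn_const.div (hG.contDiffOn.norm ℝ hne) fun x hx => norm_ne_zero_iff.2 (hne x hx)).smul
      hG.contDiffOn
  obtain ⟨L, hL⟩ := hsmooth.exists_lipschitzOnWith one_ne_zero (convex_closedBall 0 R)
    (isCompact_closedBall 0 R)
  obtain ⟨x, hx, hxne⟩ := exists_mem_sphere_ne_of_mapsTo_sphere hR hL
    ((hsmooth.differentiableOn one_ne_zero).mono ball_subset_closedBall) fun x hx => by
      rw [mem_sphere_zero_iff_norm, norm_smul, norm_div, norm_norm, Real.norm_of_nonneg hR.le,
        div_mul_cancel₀ _ (norm_ne_zero_iff.2 (hne x hx))]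
  rw [hid x hx, mem_sphere_zero_iff_norm.1 hx, div_self hR.ne', one_smul] at hxne
  exact hxne rfl

theorem exists_fixedPoint_of_contDiff_of_norm_le (hf : ContDiff ℝ 1 f) (hfR : ∀ x, ‖f x‖ ≤ R) :
    ∃ x, f x = x := by
  have hR : 0 ≤ R := (norm_nonneg _).trans (hfR 0)
  let χ : ContDiffBump (0 : E) := ⟨R + 1, R + 2, by positivity, by linarith⟩
  obtain ⟨x, -, hx⟩ := exists_mem_closedBall_eq_zero_of_contDiff (G := fun x => x - χ x • f x)
    χ.rOut_pos (contDiff_id.sub (χ.contDiff.smul hf)) fun x hx => by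
      rw [χ.zero_of_le_dist (mem_sphere.1 hx).ge, zero_smul, sub_zero]
  rw [sub_eq_zero] at hx
  have hxR : ‖x‖ ≤ R := by
    rw [hx, norm_smul, Real.norm_of_nonneg χ.nonneg]
    exact (mul_le_of_le_one_left (norm_nonneg _) χ.le_one).trans (hfR x)
  have hχ : χ x = 1 := χ.one_of_mem_closedBall
    (mem_closedBall_zero_iff.2 (hxR.trans (le_add_of_nonneg_right zero_le_one)))
  exact ⟨x, by rw [hχ, one_smul] at hx; exact hx.symm⟩

theorem exists_fixedPoint_of_continuous_of_norm_le (hf : Continuous f) (hfR : ∀ x, ‖f x‖ ≤ R) :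
    ∃ x, f x = x := by
  by_contra! hne
  obtain ⟨g, hg⟩ := exists_contMDiffMap_forall_mem_convex_of_local_const (n := 1) 𝓘(ℝ, E)
    (t := fun x => ball (f x) ‖f x - x‖ ∩ closedBall 0 R)
    (fun x => (convex_ball _ _).inter (convex_closedBall _ _)) fun x => ⟨f x, by
      have hlt : dist (f x) (f x) < ‖f x - x‖ := by
        rw [dist_self]
        exact norm_sub_pos_iff.2 (hne x)
      filter_upwards [(continuous_const.dist hf).continuousAt.eventually_lt
        (hf.sub continuous_id).norm.continuousAt hlt] with y hy
      exact ⟨hy, mem_closedBall_zero_iff.2 (hfR x)⟩⟩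
  obtain ⟨y, hy⟩ := exists_fixedPoint_of_contDiff_of_norm_le g.contMDiff.contDiff
    fun x => mem_closedBall_zero_iff.1 (hg x).2
  have hlt := mem_ball.1 (hg y).1
  rw [hy, dist_comm, dist_eq_norm] at hlt
  exact lt_irrefl _ hlt

theorem exists_mem_fixedPoint_of_isCompact_of_convex (hK : IsCompact K) (hne : K.Nonempty)
    (hconv : Convex ℝ K) (hf : ContinuousOn f K) (hfK : MapsTo f K K) : ∃ x ∈ K, f x = x := by
  obtain ⟨P, hP⟩ := exists_isMetricProjection hne hK.isComplete hconv
  obtain ⟨R, hR⟩ := isBounded_iff_forall_norm_le.1 hK.isBounded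
  obtain ⟨x, hx⟩ := exists_fixedPoint_of_continuous_of_norm_le
    (hf.comp_continuous hP.lipschitzWith.continuous hP.apply_mem)
    fun x => hR _ (hfK (hP.apply_mem x))
  have hxK : x ∈ K := hx ▸ hfK (hP.apply_mem x)
  exact ⟨x, hxK, by rwa [Function.comp_apply, hP.apply_eq_self hxK] at hx⟩

end Brouwer

section Existence

variable {E : Type*} [NormedAddCommGroup E] [InnerProductSpace ℝ E] [FiniteDimensional ℝ E]
  {K : Set E} {G : E → E} {c : ℝ}

theorem viSolutionSet_nonempty_of_isCompact (hK : IsCompact K) (hne : K.Nonempty)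
    (hconv : Convex ℝ K) (hG : ContinuousOn G K) : (viSolutionSet G K).Nonempty := by
  obtain ⟨P, hP⟩ := exists_isMetricProjection hne hK.isComplete hconv
  obtain ⟨y, -, hy⟩ := exists_mem_fixedPoint_of_isCompact_of_convex (f := fun x => P (x - G x))
    hK hne hconv (hP.lipschitzWith.continuous.comp_continuousOn (continuousOn_id.sub hG))
    fun x _ => hP.apply_mem _
  have hsol := hP (y - G y)
  rw [hy] at hsol
  exact ⟨y, hsol.1, by simpa only [sub_sub_cancel] using hsol.2⟩

theorem IsStronglyMonotoneOn.viSolutionSet_nonempty (hc : 0 < c)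
    (hmono : IsStronglyMonotoneOn c G K) (hne : K.Nonempty) (hclosed : IsClosed K)
    (hconv : Convex ℝ K) (hG : ContinuousOn G K) : (viSolutionSet G K).Nonempty := by
  obtain ⟨x, hx⟩ := hne
  let B := closedBall x (‖G x‖ / c + 1)
  have hxB : x ∈ K ∩ B := ⟨hx, mem_closedBall_self (by positivity)⟩
  obtain ⟨y, hy⟩ := viSolutionSet_nonempty_of_isCompact
    ((isCompact_closedBall _ _).inter_left hclosed) ⟨x, hxB⟩
    (hconv.inter (convex_closedBall _ _)) (hG.mono inter_subset_left)
  -- `x` solves the inequality for the zero map, so stability bounds the distance from `y` to `x`.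
  have hbound : c * ‖y - x‖ ≤ ‖G x‖ := by
    simpa only [zero_sub, norm_neg] using (hmono.mono inter_subset_left).mul_norm_sub_le hy
      (mem_viSolutionSet_of_eq_zero (G := fun _ => 0) hxB rfl)
  have hyB : B ∈ 𝓝 y := closedBall_mem_nhds_of_mem <| by
    rw [mem_ball, dist_eq_norm]
    exact ((le_div_iff₀' hc).2 hbound).trans_lt (lt_add_one _)
  exact ⟨y, mem_viSolutionSet_of_inter_nhds hconv hyB hy⟩

end Existence

theorem mainTheorem2_general {E : Type*} [NormedAddCommGroup E] [InnerProductSpace ℝ E]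
    [FiniteDimensional ℝ E] {K : Set E} (hne : K.Nonempty) (hclosed : IsClosed K)
    (hconv : Convex ℝ K) :
    (∀ G : E → E, ContinuousOn G K →
      (IsCompact K → (viSolutionSet G K).Nonempty) ∧
      (IsCompact K → IsStrictlyMonotoneOn G K → ∃! y, y ∈ viSolutionSet G K) ∧
      ((∃ c > 0, IsStronglyMonotoneOn c G K) → ∃! y, y ∈ viSolutionSet G K)) ∧
    (¬ Bornology.IsBounded K → ∃ G : E → E, ContinuousOn G K ∧ viSolutionSet G K = ∅) := by
  refine ⟨fun G hG => ⟨fun hK => ?_, fun hK hmono => ?_, fun ⟨c, hc, hmono⟩ => ?_⟩, fun hK => ?_⟩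
  · exact viSolutionSet_nonempty_of_isCompact hK hne hconv hG
  · obtain ⟨y, hy⟩ := viSolutionSet_nonempty_of_isCompact hK hne hconv hG
    exact ⟨y, hy, fun z hz => hmono.subsingleton_viSolutionSet hz hy⟩
  · obtain ⟨y, hy⟩ := hmono.viSolutionSet_nonempty hc hne hclosed hconv hG
    exact ⟨y, hy, fun z hz =>
      (hmono.isStrictlyMonotoneOn hc).subsingleton_viSolutionSet hz hy⟩
  · have : CompleteSpace E := FiniteDimensional.complete ℝ E
    obtain ⟨w, hw⟩ := exists_viSolutionSet_const_eq_empty hK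
    exact ⟨fun _ => w, continuousOn_const, hw⟩

theorem mainTheorem2 (m : ℕ) (K : Set (EuclideanSpace ℝ (Fin m)))
    (hne : K.Nonempty) (hclosed : IsClosed K) (hconv : Convex ℝ K) :
    (∀ G : EuclideanSpace ℝ (Fin m) → EuclideanSpace ℝ (Fin m), ContinuousOn G K →
      (IsCompact K → (VI.solutionSet G K).Nonempty) ∧
      (IsCompact K → VI.StrictlyMonotoneOn G K → ∃! y, y ∈ VI.solutionSet G K) ∧
      (VI.StronglyMonotoneOn G K → ∃! y, y ∈ VI.solutionSet G K)) ∧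
    (¬ Bornology.IsBounded K →
      ∃ G : EuclideanSpace ℝ (Fin m) → EuclideanSpace ℝ (Fin m),
        ContinuousOn G K ∧ VI.solutionSet G K = ∅) :=
  mainTheorem2_general hne hclosed hconv
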